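/- Let $G=(V,E)$ be a finite simple graph on $d-1$ vertices ($d\ge 1$). Call $G$ perfect if $\chi(G[W])=\omega(G[W])$ for every $W\subseteq V$ (chromatic number equals clique number for every induced subgraph), and self-complementary if $G$ is isomorphic to its complement $\overline G$. For $S\subseteq V$ let $u_S\in\{-1,+1\}^{V}$ be the vector with $(u_S)_v=+1$ if and only if $v\in S$, let $$P_G=\operatorname{conv}\{u_S : S\subseteq V \text{ independent in } G\}\subset\mathbb{R}^{V},$$ and let the Hansen polytope of $G$ be the twisted prism over $P_G$, $$H(G)=\operatorname{conv}\bigl(P_G\times\{1\}\ \cup\ (-P_G)\times\{-1\}\bigr)\subset\mathbb{R}^{V}\times\mathbb{R}\cong\mathbb{R}^{d}.$$ **Proposition.** If $G$ is perfect and self-complementary, then $H(G)$ is a centrally symmetric, self-dual $d$-polytope. That is, $H(G)$ is a polytope of dimension $d$, $H(G)=-H(G)$, and $H(G)$ is combinatorially equivalent to its polar $H(G)^{\triangle}=\{y\in\mathbb{R}^{d} : \langle x,y\rangle\le 1 \text{ for all } x\in H(G)\}$, i.e. the face lattices (faces ordered by inclusion) of $H(G)$ and $H(G)^{\triangle}$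 are isomorphic. -/

import Mathlib

open scoped Pointwise

noncomputable section

namespace Hansen

/-! Graphs -/

/-- A graph is perfect if every induced subgraph has chromatic number equal to its clique
number. -/
def IsPerfectGraph {V : Type*} (G : SimpleGraph V) : Prop :=
  ∀ s : Set V, (G.induce s).chromaticNumber = ((G.induce s).cliqueNum : ℕ∞)

/-- A graph is self-complementary if it is isomorphic to its complement. -/
def IsSelfComplementary {V : Type*} (G : SimpleGraph V) : Prop :=
  Nonempty (G ≃g Gᶜ)

/-! Polytopes in a real inner product space -/

section Polytopes

variable {E : Type*} [NormedAddCommGroup E] [InnerProductSpace ℝ E]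

/-- `P` is a `d`-polytope: the convex hull of a nonempty finite set of points, whose affine hull
has dimension `d`. -/
def IsPolytopeOfDim (d : ℕ) (P : Set E) : Prop :=
  (∃ s : Set E, s.Finite ∧ s.Nonempty ∧ P = convexHull ℝ s) ∧
    Module.finrank ℝ (vectorSpan ℝ P) = d

/-- `P` is centrally symmetric (about the origin). -/
def IsCentrallySymmetric (P : Set E) : Prop := -P = P

/-- The faces of `P`, partially ordered by inclusion; `∅` and `P` itself are faces, the other
faces are the sets of maximizers over `P` of a linear functional. -/
abbrev Face (P : Set E) : Type _ := {F : Set E // IsExposed ℝ P F}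

/-- Two polytopes are combinatorially equivalent if their face lattices are isomorphic. -/
def CombinatoriallyEquivalent {E' : Type*} [NormedAddCommGroup E'] [InnerProductSpace ℝ E']
    (P : Set E) (Q : Set E') : Prop :=
  Nonempty (Face P ≃o Face Q)

/-- The polar (dual polytope) of `P`, for `P` with the origin in its interior. -/
def polarDual (P : Set E) : Set E := {y | ∀ x ∈ P, inner ℝ x y ≤ 1}

/-- `P`, with the origin in its interior, is self-dual if it is combinatorially equivalent to its
polar. -/
def IsSelfDual (P : Set E) : Prop := CombinatoriallyEquivalent (polarDual P) P

/-- The twisted prism over `Q`: the convex hull of `Q × {1}` and `-Q × {-1}`, in the Euclidean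
product of the ambient space of `Q` with the line. -/
def twistedPrism (Q : Set E) : Set (WithLp 2 (E × ℝ)) :=
  convexHull ℝ (WithLp.toLp 2 '' (Q ×ˢ {(1 : ℝ)} ∪ (-Q) ×ˢ {(-1 : ℝ)}))

end Polytopes

/-! Hansen polytopes -/

open Classical in
/-- The `±1` characteristic vector of a set `S` of vertices. -/
def signVector {V : Type*} (S : Set V) : EuclideanSpace ℝ V :=
  WithLp.toLp 2 fun v => if v ∈ S then 1 else -1

/-- The `±1` stable-set polytope of `G`: the convex hull of the vectors of the independent
sets. -/
def stablePolytope {V : Type*} (G : SimpleGraph V) : Set (EuclideanSpace ℝ V) :=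
  convexHull ℝ {x | ∃ S : Set V, G.IsIndepSet S ∧ x = signVector S}

/-- The Hansen polytope of `G`, in the Euclidean space of dimension `|V| + 1`. -/
def hansenPolytope {V : Type*} [Fintype V] (G : SimpleGraph V) :
    Set (WithLp 2 (EuclideanSpace ℝ V × ℝ)) :=
  twistedPrism (stablePolytope G)

end Hansen

end

/-! Let `σ : G ≃g Gᶜ`. The map `dualityEquiv σ` sends `(u_S, 1)` to `(1_{σS}, |S| - 1)`. For
independent `S` and `S'` its pairing with `(u_{S'}, 1)` is `2|S' ∩ σS| - 1`, which is `±1` because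
`σS` is a clique of `G`. Hence it maps the polytope into its polar.

Perfection gives equality. For `y` in the polar put `z = y ∘ σ` and `s = ∑ y - y.snd`. Then `|2 z(C)
- s| ≤ 1` for every clique `C`, since `σC` is independent. Restricting `C` to the signs of `z`
bounds `z⁺(C)` by `(1 + s)/2` and `z⁻(C)` by `(1 - s)/2`. The clique description of the stable set
polytope (`IsPerfectGraph.exists_eq_smul`) turns `z⁺` and `z⁻` into multiples of points of that
polytope, so the preimage of `y` is a convex combination of a top point and a bottom point.

That description rests on `IsPerfectGraph.exists_weighted_coloring`, a form of Lovász's replication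
argument. -/

namespace Hansen

/-! ### Weighted colourings of perfect graphs. -/

section WeightedColoring

variable {V : Type*}

/-- A perfect graph on `s` can be coloured with as many colours as bound the sizes of the
cliques inside `s`. -/
theorem IsPerfectGraph.colorable_induce {G : SimpleGraph V} (h : IsPerfectGraph G) (s : Set V)
    (q : ℕ) (hq : ∀ C : Finset V, G.IsClique (C : Set V) → (C : Set V) ⊆ s → C.card ≤ q) :
    (G.induce s).Colorable q := by
  classical
  rw [← SimpleGraph.chromaticNumber_le_iff_colorable, h s]
  obtain ⟨t, ht⟩ := (G.induce s).exists_isNClique_cliqueNum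
  rw [← ht.card_eq, Nat.cast_le, ← Finset.card_map (Function.Embedding.subtype _)]
  refine hq _ ?_ ?_
  · have := ht.isClique
    intro a ha b hb hab
    simp only [Finset.coe_map, Set.mem_image, Function.Embedding.subtype_apply] at ha hb
    obtain ⟨a, ha, rfl⟩ := ha
    obtain ⟨b, hb, rfl⟩ := hb
    exact this ha hb fun e => hab (by rw [e])
  · intro a ha
    simp only [Finset.coe_map, Set.mem_image, Function.Embedding.subtype_apply] at ha
    obtain ⟨a, -, rfl⟩ := ha
    exact a.2

open Classical in
/-- An independent set meets a clique in at most one vertex. -/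
theorem card_inter_le_one {G : SimpleGraph V} {S C : Finset V} (hS : G.IsIndepSet (S : Set V))
    (hC : G.IsClique (C : Set V)) : (S ∩ C).card ≤ 1 := by
  rw [Finset.card_le_one]
  intro a ha b hb
  rw [Finset.mem_inter] at ha hb
  by_contra hab
  exact hS ha.1 hb.1 hab (hC ha.2 hb.2 hab)

variable [Fintype V]

open Classical in
/-- Weighted colouring of perfect graphs: if every clique has total weight at most `q`, then some
family of `q` independent sets covers every vertex exactly as often as its weight says. -/
theorem IsPerfectGraph.exists_weighted_coloring {G : SimpleGraph V} (h : IsPerfectGraph G)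
    (n : ℕ) : ∀ (k : V → ℕ) (q : ℕ), ∑ v, k v = n →
      (∀ C : Finset V, G.IsClique (C : Set V) → ∑ v ∈ C, k v ≤ q) →
      ∃ f : Fin q → Finset V, (∀ i, G.IsIndepSet (f i : Set V)) ∧
        ∀ v, ∑ i, (if v ∈ f i then 1 else 0) = k v := by
  induction n using Nat.strong_induction_on with
  | _ n ih =>
  intro k q hn hq
  by_cases hk : ∀ v, k v ≤ 1
  · obtain ⟨c⟩ := h.colorable_induce {v | k v = 1} q fun C hC hCs => by
      refine le_trans ?_ (hq C hC)
      rw [Finset.card_eq_sum_ones]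
      exact Finset.sum_le_sum fun v hv => (hCs hv).ge
    refine ⟨fun i => Finset.univ.filter fun v => ∃ hv : k v = 1, c ⟨v, hv⟩ = i, ?_, ?_⟩
    · intro i a ha b hb _ hadj
      simp only [Finset.coe_filter, Finset.mem_univ, true_and, Set.mem_ofPred_eq] at ha hb
      obtain ⟨ha, ha'⟩ := ha
      obtain ⟨hb, hb'⟩ := hb
      have hadj' : (G.induce {v | k v = 1}).Adj ⟨a, ha⟩ ⟨b, hb⟩ := hadj
      exact c.valid hadj' (ha'.trans hb'.symm)
    · intro v
      by_cases hv : k v = 1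
      · simp [hv]
      · have : k v = 0 := by have := hk v; omega
        simp [this]
  · push Not at hk
    obtain ⟨x, hx⟩ := hk
    obtain ⟨k', hk'⟩ : ∃ k' : V → ℕ, ∀ v, k' v = k v - if v = x then 1 else 0 :=
      ⟨_, fun _ => rfl⟩
    have hsum : ∀ C : Finset V,
        ∑ v ∈ C, k' v + (if x ∈ C then 1 else 0) = ∑ v ∈ C, k v := by
      intro C
      rw [← Finset.sum_ite_eq' C x fun _ => 1, ← Finset.sum_add_distrib]
      refine Finset.sum_congr rfl fun v _ => ?_
      rw [hk']
      split_ifs with hv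
      · subst hv; omega
      · rfl
    have hk'x : k' x = k x - 1 := by simp [hk']
    have hk'n : ∀ v, v ≠ x → k' v = k v := fun v hv => by simp [hk', hv]
    obtain ⟨f, hf, hfk⟩ := ih (∑ v, k' v) (by have := hsum Finset.univ; simp only [Finset.mem_univ, if_true] at this; omega) k' q
      rfl fun C hC => by have := hsum C; have := hq C hC; omega
    -- As `k x ≥ 2`, the lowered weight of `x` is still positive, so some class contains `x`.
    obtain ⟨i₀, hi₀⟩ : ∃ i, x ∈ f i := by
      by_contra hcon
      push Not at hcon
      have := hfk x
      simp [hcon] at this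
      omega
    have hA : ∀ v ∈ f i₀, 1 ≤ k' v := by
      intro v hv
      rw [← hfk v]
      refine le_trans ?_ (Finset.single_le_sum (fun i _ => Nat.zero_le _) (Finset.mem_univ i₀))
      simp [hv]
    -- Only the rest of the class is subtracted; putting back all of `f i₀` then restores the unit
    -- taken from `x`.
    set B := (f i₀).erase x with hB
    obtain ⟨k'', hk''⟩ : ∃ k'' : V → ℕ, ∀ v, k'' v = k' v - if v ∈ B then 1 else 0 :=
      ⟨_, fun _ => rfl⟩
    have hsum' : ∀ C : Finset V,
        ∑ v ∈ C, k'' v + (C ∩ B).card = ∑ v ∈ C, k' v := by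
      intro C
      rw [← Finset.filter_mem_eq_inter, Finset.card_filter, ← Finset.sum_add_distrib]
      refine Finset.sum_congr rfl fun v _ => ?_
      rw [hk'']
      split_ifs with hv
      · have := hA v (Finset.mem_of_mem_erase hv); omega
      · rfl
    obtain ⟨r, rfl⟩ : ∃ r, q = r + 1 := ⟨q - 1, by have := i₀.pos; omega⟩
    -- A clique has lost a unit if it contains `x` or meets `B`. Otherwise it misses `f i₀`, and
    -- each of the other `r` classes meets it at most once.
    have hr : ∀ C : Finset V, G.IsClique (C : Set V) → ∑ v ∈ C, k'' v ≤ r := by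
      intro C hC
      have h1 := hsum C
      have h2 := hsum' C
      have h3 := hq C hC
      by_cases hxC : x ∈ C
      · simp only [hxC, if_true] at h1; omega
      · by_cases hd : (C ∩ B).card = 0
        · have hd' : (f i₀ ∩ C).card = 0 := by
            rw [Finset.card_eq_zero] at hd ⊢
            ext v
            have := Finset.ext_iff.1 hd v
            simp only [hB, Finset.mem_inter, Finset.mem_erase, Finset.notMem_empty,
              iff_false] at this ⊢
            rintro ⟨h4, h5⟩
            exact this ⟨h5, fun e => hxC (e ▸ h5), h4⟩
          have h6 : ∑ v ∈ C, k' v = ∑ i, (f i ∩ C).card := by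
            rw [Finset.sum_congr rfl fun v _ => (hfk v).symm, Finset.sum_comm]
            refine Finset.sum_congr rfl fun i _ => ?_
            rw [Finset.inter_comm, ← Finset.filter_mem_eq_inter, Finset.card_filter]
          have h7 : ∑ i, (f i ∩ C).card ≤ r := by
            rw [← Finset.add_sum_erase _ _ (Finset.mem_univ i₀), hd', zero_add]
            refine (Finset.sum_le_card_nsmul _ _ 1 fun i _ => card_inter_le_one (hf i) hC).trans ?_
            simp
          omega
        · omega
    obtain ⟨g, hg, hgk⟩ := ih (∑ v, k'' v)
      (by
        have h1 := hsum Finset.univ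
        have h2 := hsum' Finset.univ
        simp only [Finset.mem_univ, if_true] at h1
        omega) k'' r rfl hr
    refine ⟨Fin.cons (f i₀) g, fun i => ?_, fun v => ?_⟩
    · cases i using Fin.cases with
      | zero => exact hf i₀
      | succ i => exact hg i
    · rw [Fin.sum_univ_succ]
      simp only [Fin.cons_zero, Fin.cons_succ, hgk]
      by_cases hv : v = x
      · subst hv
        simp only [hk'', hB, hi₀, hk'x, Finset.mem_erase]
        simp; omega
      · have h1 := hk'n v hv
        by_cases hvf : v ∈ f i₀
        · have := hA v hvf
          simp [hk'', hB, hv, hvf]; omega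
        · simp [hk'', hB, hvf, h1]

end WeightedColoring

/-! ### Clique inequalities for the stable set polytope. -/

section StableSetPolytope

variable {V : Type*}

open Classical in
/-- The `0/1` incidence vector of a set. -/
noncomputable def incidence (S : Set V) : V → ℝ := fun v => if v ∈ S then 1 else 0

/-- The incidence vectors of the independent sets. -/
noncomputable def stableVectors (G : SimpleGraph V) : Set (V → ℝ) := incidence '' {S | G.IsIndepSet S}

theorem finite_stableVectors [Finite V] (G : SimpleGraph V) : (stableVectors G).Finite :=
  (Set.toFinite _).image _

variable [Fintype V]

/-- A nonnegative integral weight, scaled down by a bound on its clique sums, lies in the stable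
set polytope of a perfect graph. -/
theorem IsPerfectGraph.div_mem_convexHull {G : SimpleGraph V} (h : IsPerfectGraph G)
    (k : V → ℕ) (q : ℕ) (hq0 : 0 < q)
    (hq : ∀ C : Finset V, G.IsClique (C : Set V) → ∑ v ∈ C, k v ≤ q) :
    (fun v => (k v : ℝ) / q) ∈ convexHull ℝ (stableVectors G) := by
  classical
  obtain ⟨f, hf, hfk⟩ := h.exists_weighted_coloring _ k q rfl hq
  have hq' : (q : ℝ) ≠ 0 := by positivity
  have : (fun v => (k v : ℝ) / q) = ∑ i, (1 / q : ℝ) • incidence (f i : Set V) := by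
    funext v
    rw [← hfk v, Finset.sum_apply, Nat.cast_sum, Finset.sum_div]
    refine Finset.sum_congr rfl fun i _ => ?_
    by_cases hv : v ∈ f i <;> simp [incidence, hv]
  rw [this]
  refine (convex_convexHull ℝ _).sum_mem (fun i _ => by positivity) ?_ fun i _ =>
    subset_convexHull ℝ _ ⟨_, hf i, rfl⟩
  simp [hq']

/-- The stable set polytope of a perfect graph is cut out by nonnegativity and the clique
inequalities. -/
theorem IsPerfectGraph.mem_convexHull {G : SimpleGraph V} (h : IsPerfectGraph G)
    (z : V → ℝ) (hz : ∀ v, 0 ≤ z v)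
    (hC : ∀ C : Finset V, G.IsClique (C : Set V) → ∑ v ∈ C, z v ≤ 1) :
    z ∈ convexHull ℝ (stableVectors G) := by
  -- Rounding down preserves the clique inequalities, and the hull of finitely many points is
  -- closed.
  have hlim : Filter.Tendsto (fun n : ℕ => fun v => (⌊z v * (n : ℝ)⌋₊ : ℝ) / (n : ℝ))
      Filter.atTop (nhds z) :=
    tendsto_pi_nhds.2 fun v =>
      (tendsto_nat_floor_mul_div_atTop (hz v)).comp tendsto_natCast_atTop_atTop
  refine (finite_stableVectors G).isClosed_convexHull (𝕜 := ℝ) |>.mem_of_tendsto hlim ?_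
  filter_upwards [Filter.eventually_gt_atTop 0] with n hn
  refine h.div_mem_convexHull (fun v => ⌊z v * (n : ℝ)⌋₊) n hn fun C hCC => ?_
  rw [← Nat.cast_le (α := ℝ), Nat.cast_sum]
  calc ∑ v ∈ C, (⌊z v * (n : ℝ)⌋₊ : ℝ) ≤ ∑ v ∈ C, z v * n :=
        Finset.sum_le_sum fun v _ => Nat.floor_le (mul_nonneg (hz v) n.cast_nonneg)
    _ = (∑ v ∈ C, z v) * n := by rw [Finset.sum_mul]
    _ ≤ 1 * n := mul_le_mul_of_nonneg_right (hC C hCC) n.cast_nonneg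
    _ = n := one_mul _

/-- The homogeneous form of `IsPerfectGraph.mem_convexHull`. -/
theorem IsPerfectGraph.exists_eq_smul {G : SimpleGraph V} (h : IsPerfectGraph G)
    (z : V → ℝ) (hz : ∀ v, 0 ≤ z v) (a : ℝ) (ha : 0 ≤ a)
    (hC : ∀ C : Finset V, G.IsClique (C : Set V) → ∑ v ∈ C, z v ≤ a) :
    ∃ p ∈ convexHull ℝ (stableVectors G), z = a • p := by
  rcases ha.eq_or_lt with rfl | ha
  -- For `a = 0` the one-vertex cliques force `z = 0`.
  · refine ⟨0, h.mem_convexHull 0 (fun _ => le_rfl) fun C _ => by simp, ?_⟩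
    funext v
    have := hC {v} (by simp)
    have := hz v
    simp at *
    linarith
  · refine ⟨a⁻¹ • z, h.mem_convexHull _ (fun v => ?_) fun C hCC => ?_, ?_⟩
    · exact mul_nonneg (by positivity) (hz v)
    · simp only [Pi.smul_apply, smul_eq_mul, ← Finset.mul_sum]
      rw [inv_mul_le_one₀ ha]
      exact hC C hCC
    · rw [smul_smul, mul_inv_cancel₀ ha.ne', one_smul]

end StableSetPolytope

/-! ### Linear images of faces, and polars of convex hulls. -/

section Faces

variable {E E' : Type*} [NormedAddCommGroup E] [InnerProductSpace ℝ E]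
  [NormedAddCommGroup E'] [InnerProductSpace ℝ E']

theorem isExposed_image (T : E ≃L[ℝ] E') {P F : Set E} (h : IsExposed ℝ P F) :
    IsExposed ℝ (T '' P) (T '' F) := by
  intro hne
  obtain ⟨l, hl⟩ := h hne.of_image
  refine ⟨l.comp (T.symm : E' →L[ℝ] E), ?_⟩
  ext y
  obtain ⟨x, rfl⟩ := T.surjective y
  rw [T.injective.mem_set_image, hl]
  simp

/-- Linearly equivalent sets are combinatorially equivalent. -/
theorem CombinatoriallyEquivalent.of_image_eq (T : E ≃L[ℝ] E') {P : Set E} {Q : Set E'}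
    (h : T '' P = Q) : CombinatoriallyEquivalent P Q := by
  have hs : T.symm '' Q = P := by rw [← h, ← Set.image_comp]; simp
  refine ⟨{
    toFun := fun F => ⟨T '' F.1, h ▸ isExposed_image T F.2⟩
    invFun := fun F => ⟨T.symm '' F.1, hs ▸ isExposed_image T.symm F.2⟩
    left_inv := fun F => Subtype.ext (by simp [← Set.image_comp])
    right_inv := fun F => Subtype.ext (by simp [← Set.image_comp])
    map_rel_iff' := ?_ }⟩
  intro F F'
  exact Set.image_subset_image_iff T.injective

theorem CombinatoriallyEquivalent.of_linearEquiv [FiniteDimensional ℝ E] (T : E ≃ₗ[ℝ] E')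
    {P : Set E} {Q : Set E'} (h : T '' P = Q) : CombinatoriallyEquivalent Q P := by
  refine .of_image_eq T.toContinuousLinearEquiv.symm ?_
  rw [← h, ← Set.image_comp]
  convert Set.image_id _
  ext1 x
  exact T.symm_apply_apply x

theorem convex_polarDual (P : Set E) : Convex ℝ (polarDual P) := by
  intro x hx y hy a b ha hb hab p hp
  rw [inner_add_right, inner_smul_right, inner_smul_right]
  have h1 := mul_le_mul_of_nonneg_left (hx p hp) ha
  have h2 := mul_le_mul_of_nonneg_left (hy p hp) hb
  linarith

theorem mem_polarDual_convexHull (P : Set E) (y : E) :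
    y ∈ polarDual (convexHull ℝ P) ↔ ∀ x ∈ P, inner ℝ x y ≤ 1 := by
  refine ⟨fun h x hx => h x (subset_convexHull ℝ _ hx), fun h => ?_⟩
  have hc : Convex ℝ {x : E | inner ℝ x y ≤ 1} := by
    intro x hx z hz a b ha hb hab
    simp only [Set.mem_ofPred_eq] at *
    rw [inner_add_left, real_inner_smul_left, real_inner_smul_left]
    have h1 := mul_le_mul_of_nonneg_left hx ha
    have h2 := mul_le_mul_of_nonneg_left hz hb
    linarith
  exact fun x hx => convexHull_min h hc hx

end Faces

/-! ### Vertices, symmetry and dimension of the Hansen polytope; the duality map. -/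

section HansenPolytope

variable {V : Type*}

/-- The point `(u_S, 1)` of the Hansen polytope. -/
noncomputable def liftedSign (S : Set V) : WithLp 2 (EuclideanSpace ℝ V × ℝ) := WithLp.toLp 2 (signVector S, 1)

/-- The points `(u_S, 1)` with `S` independent. -/
noncomputable def upperVertices (G : SimpleGraph V) : Set (WithLp 2 (EuclideanSpace ℝ V × ℝ)) :=
  liftedSign '' {S | G.IsIndepSet S}

theorem finite_upperVertices [Finite V] (G : SimpleGraph V) : (upperVertices G).Finite :=
  (Set.toFinite _).image _

variable [Fintype V]

theorem hansenPolytope_eq (G : SimpleGraph V) :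
    hansenPolytope G = convexHull ℝ (upperVertices G ∪ -upperVertices G) := by
  set X : Set (EuclideanSpace ℝ V) := {x | ∃ S : Set V, G.IsIndepSet S ∧ x = signVector S}
  have e : ∀ s : Set (EuclideanSpace ℝ V × ℝ), convexHull ℝ (WithLp.toLp 2 '' s) =
      WithLp.toLp 2 '' convexHull ℝ s := fun s =>
    ((WithLp.linearEquiv 2 ℝ (EuclideanSpace ℝ V × ℝ)).symm.toLinearMap.image_convexHull s).symm
  have h1 : WithLp.toLp 2 '' (X ×ˢ {(1 : ℝ)}) = upperVertices G := by
    ext p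
    constructor
    · rintro ⟨⟨x, t⟩, ⟨⟨S, hS, hx⟩, ht⟩, rfl⟩
      exact ⟨S, hS, by simp_all [liftedSign]⟩
    · rintro ⟨S, hS, rfl⟩
      exact ⟨(signVector S, 1), ⟨⟨S, hS, rfl⟩, rfl⟩, rfl⟩
  have h2 : WithLp.toLp 2 '' ((-X) ×ˢ {(-1 : ℝ)}) = -upperVertices G := by
    rw [← h1]
    ext p
    constructor
    · rintro ⟨⟨x, t⟩, ⟨hx, ht⟩, rfl⟩
      refine ⟨(-x, -t), ⟨hx, by simp_all⟩, ?_⟩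
      rw [← WithLp.toLp_neg]; rfl
    · rintro ⟨⟨x, t⟩, ⟨hx, ht⟩, hp⟩
      refine ⟨(-x, -t), ⟨by simpa using hx, by simp_all⟩, ?_⟩
      rw [← neg_neg p, ← hp, ← WithLp.toLp_neg]; rfl
  unfold hansenPolytope twistedPrism stablePolytope
  rw [← h2, ← h1, ← Set.image_union, e, e]
  congr 1
  rw [← convexHull_neg, ← convexHull_singleton (𝕜 := ℝ) (1 : ℝ),
    ← convexHull_singleton (𝕜 := ℝ) (-1 : ℝ), ← convexHull_prod, ← convexHull_prod,
    convexHull_convexHull_union_left, convexHull_convexHull_union_right,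
    convexHull_singleton, convexHull_singleton]

theorem neg_hansenPolytope (G : SimpleGraph V) : -hansenPolytope G = hansenPolytope G := by
  rw [hansenPolytope_eq, ← convexHull_neg, Set.union_neg, neg_neg, Set.union_comm]

theorem convex_hansenPolytope (G : SimpleGraph V) : Convex ℝ (hansenPolytope G) :=
  convex_convexHull ℝ _

theorem liftedSign_mem {G : SimpleGraph V} {S : Set V} (hS : G.IsIndepSet S) :
    liftedSign S ∈ hansenPolytope G := by
  rw [hansenPolytope_eq]
  exact subset_convexHull ℝ _ (Or.inl ⟨S, hS, rfl⟩)

theorem neg_mem_hansenPolytope {G : SimpleGraph V} {p : WithLp 2 (EuclideanSpace ℝ V × ℝ)}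
    (hp : p ∈ hansenPolytope G) : -p ∈ hansenPolytope G := by
  rw [← neg_hansenPolytope]
  simpa using hp

/-- The empty set and singletons are independent in any graph: `liftedSign {v} - liftedSign ∅` is
twice a basis vector, and central symmetry supplies `2 • liftedSign ∅` for the last direction. -/
theorem vectorSpan_hansenPolytope (G : SimpleGraph V) :
    vectorSpan ℝ (hansenPolytope G) = ⊤ := by
  classical
  have h0 : liftedSign (∅ : Set V) ∈ hansenPolytope G := liftedSign_mem (by simp)
  have hd : (2 : ℝ) • liftedSign (∅ : Set V) ∈ vectorSpan ℝ (hansenPolytope G) := by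
    have := vsub_mem_vectorSpan ℝ h0 (neg_mem_hansenPolytope h0)
    rwa [vsub_eq_sub, sub_neg_eq_add, ← two_smul ℝ] at this
  have hv : ∀ v : V, liftedSign {v} - liftedSign (∅ : Set V) ∈
      vectorSpan ℝ (hansenPolytope G) := fun v =>
    vsub_mem_vectorSpan ℝ (liftedSign_mem (by simp)) h0
  rw [eq_top_iff]
  intro p _
  have : p = (p.snd / 2) • (2 : ℝ) • liftedSign (∅ : Set V) +
      ∑ v, ((p.fst v + p.snd) / 2) • (liftedSign {v} - liftedSign (∅ : Set V)) := by
    apply (WithLp.linearEquiv 2 ℝ (EuclideanSpace ℝ V × ℝ)).injective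
    rw [map_add, map_sum]
    apply Prod.ext
    · ext w
      have hw : ∀ v, ((p.fst v + p.snd) / 2) * ((if w = v then 1 else -1) + 1) =
          if w = v then p.fst v + p.snd else 0 := by
        intro v
        split_ifs <;> ring
      simp only [liftedSign, signVector, WithLp.coe_linearEquiv, WithLp.ofLp_smul,
        WithLp.ofLp_sub, Prod.fst_add, Prod.fst_sum, PiLp.add_apply, Prod.smul_fst, Prod.fst_sub,
        WithLp.ofLp_sum, Finset.sum_apply, PiLp.smul_apply]
      simp [hw]
    · simp [liftedSign, Prod.snd_sum]
  rw [this]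
  exact Submodule.add_mem _ (Submodule.smul_mem _ _ hd)
    (Submodule.sum_mem _ fun v _ => Submodule.smul_mem _ _ (hv v))

theorem isPolytopeOfDim_hansenPolytope (G : SimpleGraph V) :
    IsPolytopeOfDim (Fintype.card V + 1) (hansenPolytope G) := by
  refine ⟨⟨_, (finite_upperVertices G).union (finite_upperVertices G).neg, ?_,
    hansenPolytope_eq G⟩, ?_⟩
  · exact ⟨_, Or.inl ⟨∅, by simp, rfl⟩⟩
  · rw [vectorSpan_hansenPolytope, finrank_top,
      (WithLp.linearEquiv 2 ℝ (EuclideanSpace ℝ V × ℝ)).finrank_eq, Module.finrank_prod]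
    simp

/-- The linear automorphism `(x, t) ↦ ((x ∘ σ⁻¹ + t) / 2, ∑ (x + t) / 2 - t)`. -/
noncomputable def dualityEquiv (σ : V ≃ V) :
    WithLp 2 (EuclideanSpace ℝ V × ℝ) ≃ₗ[ℝ] WithLp 2 (EuclideanSpace ℝ V × ℝ) where
  toFun p := WithLp.toLp 2 (WithLp.toLp 2 fun v => (p.fst (σ.symm v) + p.snd) / 2,
    ∑ v, (p.fst v + p.snd) / 2 - p.snd)
  invFun y := WithLp.toLp 2 (WithLp.toLp 2 fun v => 2 * y.fst (σ v) - (∑ u, y.fst u - y.snd),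
    ∑ u, y.fst u - y.snd)
  map_add' p q := by
    apply (WithLp.linearEquiv 2 ℝ (EuclideanSpace ℝ V × ℝ)).injective
    apply Prod.ext
    · ext v; simp; ring
    · simp [add_div, Finset.sum_add_distrib]; ring
  map_smul' c p := by
    apply (WithLp.linearEquiv 2 ℝ (EuclideanSpace ℝ V × ℝ)).injective
    apply Prod.ext
    · ext v; simp; ring
    · simp [mul_sub, Finset.mul_sum, mul_add, add_div, mul_div_assoc]
  left_inv p := by
    have := Equiv.sum_comp σ.symm fun v => (p.fst v + p.snd) / 2
    apply (WithLp.linearEquiv 2 ℝ (EuclideanSpace ℝ V × ℝ)).injective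
    apply Prod.ext
    · ext v; simp at this ⊢; rw [this]; ring
    · simp at this ⊢; rw [this]; ring
  right_inv y := by
    have := Equiv.sum_comp σ fun v => y.fst v
    apply (WithLp.linearEquiv 2 ℝ (EuclideanSpace ℝ V × ℝ)).injective
    apply Prod.ext
    · ext v; simp
    · simp at this ⊢; rw [this]; ring

end HansenPolytope

/-! ### The duality map carries the polytope onto its polar. -/

section SelfDuality

variable {V : Type*}

theorem signVector_apply (S : Set V) (v : V) : signVector S v = 2 * incidence S v - 1 := by
  by_cases hv : v ∈ S
  · simp [signVector, incidence, hv]; norm_num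
  · simp [signVector, incidence, hv]

theorem isIndepSet_image_iso {G : SimpleGraph V} (σ : G ≃g Gᶜ) {C : Set V} (hC : G.IsClique C) :
    G.IsIndepSet (σ '' C) := by
  rintro _ ⟨a, ha, rfl⟩ _ ⟨b, hb, rfl⟩ hab hadj
  have := σ.map_rel_iff.2 (hC ha hb fun e => hab (by rw [e]))
  rw [SimpleGraph.compl_adj] at this
  exact this.2 hadj

theorem isClique_preimage_iso {G : SimpleGraph V} (σ : G ≃g Gᶜ) {S : Set V}
    (hS : G.IsIndepSet S) : G.IsClique (σ ⁻¹' S) := by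
  intro a ha b hb hab
  have hne : σ a ≠ σ b := fun e => hab (σ.injective e)
  rw [← σ.map_rel_iff, SimpleGraph.compl_adj]
  exact ⟨hne, hS ha hb hne⟩

variable [Fintype V]

/-- The subtracted term does not depend on `S`; it is the last coordinate of the preimage of `y`
under `dualityEquiv`. -/
theorem inner_liftedSign (S : Set V) (y : WithLp 2 (EuclideanSpace ℝ V × ℝ)) :
    inner ℝ (liftedSign S) y =
      2 * ∑ v, incidence S v * y.fst v - (∑ v, y.fst v - y.snd) := by
  simp only [WithLp.prod_inner_apply, liftedSign, PiLp.inner_apply, signVector_apply]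
  simp [mul_sub, Finset.mul_sum, Finset.sum_sub_distrib]
  have : ∀ v, y.fst v * (2 * incidence S v) = 2 * (incidence S v * y.fst v) := fun v => by ring
  simp only [this]
  ring

/-- A point of the stable set polytope in `0/1` coordinates lies, after the change to `±1`
coordinates, in the top facet of the Hansen polytope. -/
theorem lift_mem_hansenPolytope {G : SimpleGraph V} {p : V → ℝ}
    (hp : p ∈ convexHull ℝ (stableVectors G)) :
    WithLp.toLp 2 ((WithLp.toLp 2 fun v => 2 * p v - 1 : EuclideanSpace ℝ V), (1 : ℝ)) ∈
      hansenPolytope G := by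
  have hc : Convex ℝ {p : V → ℝ |
      WithLp.toLp 2 ((WithLp.toLp 2 fun v => 2 * p v - 1 : EuclideanSpace ℝ V), (1 : ℝ)) ∈
        hansenPolytope G} := by
    intro p hp q hq a b ha hb hab
    rw [Set.mem_ofPred_eq]
    convert convex_hansenPolytope G hp hq ha hb hab using 1
    apply (WithLp.linearEquiv 2 ℝ (EuclideanSpace ℝ V × ℝ)).injective
    apply Prod.ext
    · ext v
      simp
      linear_combination hab
    · simp [hab]
  refine convexHull_min ?_ hc hp
  rintro _ ⟨S, hS, rfl⟩
  rw [Set.mem_ofPred_eq]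
  convert liftedSign_mem hS using 1
  apply (WithLp.linearEquiv 2 ℝ (EuclideanSpace ℝ V × ℝ)).injective
  apply Prod.ext
  · ext v
    simp [liftedSign, signVector_apply]
  · rfl

/-- An independent set and the preimage of another under `G ≃g Gᶜ` share at most one vertex, so the
pairing of the corresponding vertices is `1` or `-1`. -/
theorem abs_inner_dualityEquiv_le_one {G : SimpleGraph V} (σ : G ≃g Gᶜ) {S S' : Set V}
    (hS : G.IsIndepSet S) (hS' : G.IsIndepSet S') :
    |inner ℝ (liftedSign S) (dualityEquiv σ.toEquiv (liftedSign S'))| ≤ 1 := by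
  classical
  have h1 : ∀ v, (dualityEquiv σ.toEquiv (liftedSign S')).fst v = incidence S' (σ.symm v) := by
    intro v
    simp [dualityEquiv, liftedSign, signVector_apply]
    rfl
  have h2 : ∑ v, (dualityEquiv σ.toEquiv (liftedSign S')).fst v -
      (dualityEquiv σ.toEquiv (liftedSign S')).snd = 1 := by
    rw [Finset.sum_congr rfl fun v _ => h1 v,
      show ∑ v, incidence S' (σ.symm v) = _ from Equiv.sum_comp σ.symm.toEquiv (incidence S')]
    simp [dualityEquiv, liftedSign, signVector_apply]
  rw [inner_liftedSign, h2]
  have h3 : ∑ v, incidence S v * (dualityEquiv σ.toEquiv (liftedSign S')).fst v =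
      ((S'.toFinset ∩ (σ ⁻¹' S).toFinset).card : ℝ) := by
    rw [← Equiv.sum_comp σ.toEquiv, ← Set.toFinset_inter,
      ← Finset.filter_univ_mem (S' ∩ σ ⁻¹' S).toFinset, Finset.card_filter, Nat.cast_sum]
    refine Finset.sum_congr rfl fun v _ => ?_
    rw [h1]
    by_cases hv : v ∈ S' <;> by_cases hv' : σ v ∈ S <;> simp [incidence, hv, hv']
  have h4 : (S'.toFinset ∩ (σ ⁻¹' S).toFinset).card ≤ 1 :=
    card_inter_le_one (G := G) (by simpa using hS') (by simpa using isClique_preimage_iso σ hS)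
  rw [h3]
  interval_cases (S'.toFinset ∩ (σ ⁻¹' S).toFinset).card <;> norm_num

theorem image_dualityEquiv_subset {G : SimpleGraph V} (σ : G ≃g Gᶜ) :
    dualityEquiv σ.toEquiv '' hansenPolytope G ⊆ polarDual (hansenPolytope G) := by
  have e : dualityEquiv σ.toEquiv '' hansenPolytope G =
      convexHull ℝ (dualityEquiv σ.toEquiv '' (upperVertices G ∪ -upperVertices G)) := by
    rw [hansenPolytope_eq]
    exact (dualityEquiv σ.toEquiv).toLinearMap.image_convexHull _
  rw [e]
  refine convexHull_min ?_ (convex_polarDual _)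
  rintro _ ⟨x, hx, rfl⟩
  rw [hansenPolytope_eq, mem_polarDual_convexHull]
  have key : ∀ x ∈ upperVertices G, ∀ x' ∈ upperVertices G,
      |inner ℝ x (dualityEquiv σ.toEquiv x')| ≤ 1 := by
    rintro _ ⟨S, hS, rfl⟩ _ ⟨S', hS', rfl⟩
    exact abs_inner_dualityEquiv_le_one σ hS hS'
  rintro x' (hx' | hx') <;> rcases hx with hx | hx <;>
  · have := abs_le.1 (key _ hx' _ hx)
    try simp only [map_neg, inner_neg_left, inner_neg_right, neg_neg] at this ⊢
    linarith

theorem polarDual_subset_image {G : SimpleGraph V} (hG : IsPerfectGraph G) (σ : G ≃g Gᶜ) :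
    polarDual (hansenPolytope G) ⊆ dualityEquiv σ.toEquiv '' hansenPolytope G := by
  classical
  intro y hy
  set s := ∑ v, y.fst v - y.snd with hs
  have hbound : ∀ C : Finset V, G.IsClique (C : Set V) →
      |2 * ∑ v ∈ C, y.fst (σ v) - s| ≤ 1 := by
    intro C hC
    have hmem := liftedSign_mem (isIndepSet_image_iso σ hC)
    have h1 : ∑ v, incidence (σ '' (C : Set V)) v * y.fst v = ∑ v ∈ C, y.fst (σ v) := by
      rw [← Equiv.sum_comp σ.toEquiv]
      simp [incidence]
    have h2 := hy _ hmem
    have h3 := hy _ (neg_mem_hansenPolytope hmem)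
    rw [inner_neg_left] at h3
    rw [inner_liftedSign, h1] at h2 h3
    exact abs_le.2 ⟨by linarith, h2⟩
  have h0 := abs_le.1 (hbound ∅ (by simp))
  simp only [Finset.sum_empty] at h0
  -- The sum of `z⁺` over `C` is the sum of `z` over the subclique where `z ≥ 0`, to which the upper
  -- bound applies.
  obtain ⟨p, hp, hp'⟩ := hG.exists_eq_smul (fun v => max (y.fst (σ v)) 0)
    (fun v => le_max_right _ _) ((1 + s) / 2) (by linarith) fun C hC => by
      have := (abs_le.1 (hbound (C.filter fun v => 0 ≤ y.fst (σ v))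
        (hC.subset fun v hv => (Finset.mem_filter.1 hv).1))).2
      rw [Finset.sum_filter] at this
      have e : ∀ v, max (y.fst (σ v)) 0 = if 0 ≤ y.fst (σ v) then y.fst (σ v) else 0 := by
        intro v
        split_ifs with hv
        · exact max_eq_left hv
        · exact max_eq_right (le_of_not_ge hv)
      simp only [e]
      linarith
  obtain ⟨q, hq, hq'⟩ := hG.exists_eq_smul (fun v => max (-y.fst (σ v)) 0)
    (fun v => le_max_right _ _) ((1 - s) / 2) (by linarith) fun C hC => by
      have := (abs_le.1 (hbound (C.filter fun v => y.fst (σ v) ≤ 0)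
        (hC.subset fun v hv => (Finset.mem_filter.1 hv).1))).1
      rw [Finset.sum_filter] at this
      have e : ∀ v, max (-y.fst (σ v)) 0 = -if y.fst (σ v) ≤ 0 then y.fst (σ v) else 0 := by
        intro v
        split_ifs with hv
        · exact max_eq_left (by linarith)
        · rw [max_eq_right (by linarith), neg_zero]
      simp only [e, Finset.sum_neg_distrib]
      linarith
  refine ⟨(dualityEquiv σ.toEquiv).symm y, ?_, LinearEquiv.apply_symm_apply _ _⟩
  -- From `z = z⁺ - z⁻`: `(2z - s, s) = (1 + s)/2 • (2p - 1, 1) + (1 - s)/2 • -(2q - 1, 1)`.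
  convert convex_hansenPolytope G (lift_mem_hansenPolytope hp)
    (neg_mem_hansenPolytope (lift_mem_hansenPolytope hq))
    (a := (1 + s) / 2) (b := (1 - s) / 2) (by linarith) (by linarith) (by ring) using 1
  apply (WithLp.linearEquiv 2 ℝ (EuclideanSpace ℝ V × ℝ)).injective
  apply Prod.ext
  · ext v
    have h1 := congrFun hp' v
    have h2 := congrFun hq' v
    have h3 := max_zero_sub_eq_self (y.fst (σ v))
    simp only [Pi.smul_apply, smul_eq_mul] at h1 h2
    rw [max_comm, max_comm 0] at h3
    have : (dualityEquiv σ.toEquiv).symm y = WithLp.toLp 2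
      (WithLp.toLp 2 fun v => 2 * y.fst (σ v) - s, s) := rfl
    rw [this]
    simp
    linear_combination 2 * h1 - 2 * h2 - 2 * h3
  · have : (dualityEquiv σ.toEquiv).symm y = WithLp.toLp 2
      (WithLp.toLp 2 fun v => 2 * y.fst (σ v) - s, s) := rfl
    rw [this]
    simp
    ring

theorem isSelfDual_hansenPolytope {G : SimpleGraph V} (hG : IsPerfectGraph G)
    (hself : IsSelfComplementary G) : IsSelfDual (hansenPolytope G) := by
  obtain ⟨σ⟩ := hself
  exact .of_linearEquiv (dualityEquiv σ.toEquiv)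
    ((image_dualityEquiv_subset σ).antisymm (polarDual_subset_image hG σ))

end SelfDuality

end Hansen

theorem mainTheorem6 {V : Type*} [Fintype V] (d : ℕ) (hd : 1 ≤ d) (hV : Fintype.card V = d - 1)
    (G : SimpleGraph V) (hperf : Hansen.IsPerfectGraph G)
    (hself : Hansen.IsSelfComplementary G) :
    Hansen.IsPolytopeOfDim d (Hansen.hansenPolytope G) ∧
      Hansen.IsCentrallySymmetric (Hansen.hansenPolytope G) ∧
      Hansen.IsSelfDual (Hansen.hansenPolytope G) := by
  obtain rfl : d = Fintype.card V + 1 := by omega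
  exact ⟨Hansen.isPolytopeOfDim_hansenPolytope G, Hansen.neg_hansenPolytope G,
    Hansen.isSelfDual_hansenPolytope hperf hself⟩
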